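/- Let $\theta_1,\theta_2\in(0,1)$ and let $\mathcal H$ be a real Hilbert space. For $\theta\in(0,1)$ let $\mathcal N_\theta$ be the class of operators $(1-\theta)I+\theta N$ with $N:\mathcal H\to\mathcal H$ nonexpansive (1-Lipschitz), let $\mathcal N_{\theta_1}\mathcal N_{\theta_2}=\{N_1N_2 : N_1\in\mathcal N_{\theta_1},\ N_2\in\mathcal N_{\theta_2}\}$ be the class of compositions, and let $\mathrm{Disk}(\theta)=\{z\in\mathbb C : |z-(1-\theta)|\le\theta\}$. The scaled relative graph of an operator $A$ on $\mathcal H$ is $$\mathcal G(A)=\left\{\tfrac{\|u-v\|}{\|x-y\|}\,e^{\pm i\angle(u-v,\,x-y)} : u\in Ax,\ v\in Ay,\ x\ne y\right\},$$ together with $\infty$ if $A$ is multi-valued, where $\angle(a,b)=\arccos\frac{\langle a,b\rangle}{\|a\|\|b\|}$ if $a,b\neq0$ and $\angle(a,b)=0$ otherwise; for a class $\mathcal A$ put $\mathcal G(\mathcal A)=\bigcup_{A\in\mathcal A}\mathcal G(A)$. Let $\Gamma\subset\mathbb C$ be the set of all points $re^{i\varphi}$ with $r,\varphi\in\mathbb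 R$ ($r$ may be negative) such that $$r^2-2r\bigl(\cos(\varphi)(1-\theta_1)(1-\theta_2)+\theta_1\theta_2\bigr)+(1-2\theta_1)(1-2\theta_2)=0 .$$ Let $S$, the outer curve of $\Gamma$, be the boundary of the unbounded connected component of $\mathbb C\setminus\Gamma$, and let $S_{\mathrm{enc}}$, the region enclosed by $S$, be the union of $S$ and the bounded connected components of $\mathbb C\setminus S$. Then $$\mathcal G(\mathcal N_{\theta_1}\mathcal N_{\theta_2})\subseteq S_{\mathrm{enc}},\qquad \mathcal G(\mathcal N_{\theta_1}\mathcal N_{\theta_2})=S_{\mathrm{enc}}\ \text{ if }\dim\mathcal H\ge 2,$$ and $$\mathrm{Disk}(\theta_1)\,\mathrm{Disk}(\theta_2)=S_{\mathrm{enc}},$$ where $\mathrm{Disk}(\theta_1)\,\mathrm{Disk}(\theta_2)=\{z_1z_2 : z_1\in\mathrm{Disk}(\theta_1),\ z_2\in\mathrm{Disk}(\theta_2)\}$. -/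

import Mathlib

open scoped Pointwise

noncomputable section

namespace SRG

section Operators

variable {H : Type*} [NormedAddCommGroup H] [InnerProductSpace ℝ H]

/-- A (possibly multi-valued) operator `H ⇉ H`, sending each point to a set of values. -/
abbrev Operator (H : Type*) := H → Set H

/-- `A` is multi-valued: some point has at least two values. -/
def Operator.IsMultiValued (A : Operator H) : Prop :=
  ∃ x, (A x).Nontrivial

/-- The composition `A B` of two operators, `(A B) x = ⋃ y ∈ B x, A y`. -/
def Operator.comp (A B : Operator H) : Operator H :=
  fun x => {z | ∃ y ∈ B x, z ∈ A y}

open Classical in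
/-- The angle in `[0, π]` between two vectors, with the convention that it is `0` if one of
the vectors vanishes. -/
def angle (a b : H) : ℝ :=
  if a ≠ 0 ∧ b ≠ 0 then Real.arccos (inner ℝ a b / (‖a‖ * ‖b‖)) else 0

/-- The scaled relative graph of an operator, a subset of the extended complex plane. -/
def srg (A : Operator H) : Set (OnePoint ℂ) :=
  {w | ∃ x y u v : H, u ∈ A x ∧ v ∈ A y ∧ x ≠ y ∧
      ∃ s : ℝ, (s = 1 ∨ s = -1) ∧
        w = (((‖u - v‖ / ‖x - y‖ : ℝ) *
              Complex.exp (s * angle (u - v) (x - y) * Complex.I) : ℂ) : OnePoint ℂ)} ∪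
    {w | w = OnePoint.infty ∧ A.IsMultiValued}

/-- The scaled relative graph of a class of operators. -/
def srgClass (𝒜 : Set (Operator H)) : Set (OnePoint ℂ) :=
  ⋃ A ∈ 𝒜, srg A

variable (H) in
/-- The class of `θ`-averaged operators on `H`: `A = (1 - θ) I + θ N` with
`N : H → H` nonexpansive. -/
def averaged (θ : ℝ) : Set (Operator H) :=
  {A | ∃ N : H → H, (∀ x y, ‖N x - N y‖ ≤ ‖x - y‖) ∧
    ∀ x, A x = {(1 - θ) • x + θ • N x}}

/-- The class of all compositions of an operator in `𝒜` with an operator in `ℬ`. -/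
def compClass (𝒜 ℬ : Set (Operator H)) : Set (Operator H) :=
  {T | ∃ A ∈ 𝒜, ∃ B ∈ ℬ, T = A.comp B}

end Operators

/-- The closed disk with center `1 - θ` and radius `θ`. -/
def Disk (θ : ℝ) : Set ℂ :=
  {z | ‖z - ((1 - θ : ℝ) : ℂ)‖ ≤ θ}

/-- The Cartesian oval: all points with polar coordinates `(r, φ)`, where `r` may be any real
number (also a negative one), that solve the given equation. -/
def cartesianOval (θ₁ θ₂ : ℝ) : Set ℂ :=
  {z | ∃ r φ : ℝ, z = r * Complex.exp (φ * Complex.I) ∧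
    r ^ 2 - 2 * r * (Real.cos φ * (1 - θ₁) * (1 - θ₂) + θ₁ * θ₂)
      + (1 - 2 * θ₁) * (1 - 2 * θ₂) = 0}

/-- The exterior of a planar set `S`: the union of the unbounded connected components of its
complement. -/
def exterior (S : Set ℂ) : Set ℂ :=
  {z | z ∈ Sᶜ ∧ ¬ Bornology.IsBounded (connectedComponentIn Sᶜ z)}

/-- The outer branch of a planar curve `S`: the part of `S` that borders its exterior. -/
def outerCurve (S : Set ℂ) : Set ℂ :=
  frontier (exterior S)

/-- The (closed) region enclosed by a planar curve `S`: the points of `S` and those in a bounded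
connected component of its complement. -/
def enclosedRegion (S : Set ℂ) : Set ℂ :=
  {z | z ∈ S ∨ Bornology.IsBounded (connectedComponentIn Sᶜ z)}

end SRG

end

/-! Put P = `Disk θ₁ * Disk θ₂`. Both the relative graph and the enclosed region are compared with
P. Geometry of P: z lies in P iff some w in `Disk θ₁` satisfies |z - (1 - θ₂)w| ≤ θ₂|w|. For fixed z
this is an Apollonius condition on w: a disk, a half-plane or the outside of a disk, according to
the sign of 1 - 2θ₂ (`norm_sub_sq_sub_sq`). Asking that it meet `Disk θ₁` gives one inequality in
|z| and Re z, whose equality case is the oval equation with r = |z|. Hence the frontier of P lies in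
the oval, and the oval lies in P. Points off P escape to infinity in the complement of P
(`exists_escape`), so P is exactly what the outer curve encloses (`enclosedRegion_outerCurve`).
Operators: averagedness says that increments are related by a point of the disk. Under composition
norm ratios multiply and angles obey the triangle inequality; lost angle is harmless, since rotating
towards the positive axis stays in the disk. In dimension at least 2, multiplication by z₁ and z₂ on
a plane realizes every product. -/

namespace SRG

/-! ### Regions enclosed by planar curves -/

section Topology

/-- A preconnected set that meets a closed set but not its frontier lies in it. -/
theorem isPreconnected_subset_of_disjoint_frontier {t P : Set ℂ} (ht : IsPreconnected t)
    (hP : IsClosed P) (hd : Disjoint t (frontier P)) (hne : (t ∩ P).Nonempty) : t ⊆ P := by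
  have hcov : t ⊆ interior P ∪ Pᶜ := by
    intro x hx
    by_cases hxP : x ∈ P
    · left
      by_contra hxi
      exact Set.disjoint_left.1 hd hx (by rw [hP.frontier_eq]; exact ⟨hxP, hxi⟩)
    · exact Or.inr hxP
  have hdis : Disjoint (interior P) Pᶜ :=
    Set.disjoint_left.2 fun x hx hx' => hx' (interior_subset hx)
  rcases IsPreconnected.subset_or_subset isOpen_interior hP.isOpen_compl hdis hcov ht with h | h
  · exact h.trans interior_subset
  · obtain ⟨x, hx, hxP⟩ := hne
    exact absurd hxP (h hx)

/-- Components of the complement of a set containing the frontier of `P` stay in `P`. -/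
theorem isBounded_connectedComponentIn_of_mem {P C : Set ℂ} (hP : IsCompact P)
    (hC : frontier P ⊆ C) {z : ℂ} (hz : z ∈ P) :
    Bornology.IsBounded (connectedComponentIn Cᶜ z) := by
  by_cases hzC : z ∈ Cᶜ
  · refine hP.isBounded.subset (isPreconnected_subset_of_disjoint_frontier
      isPreconnected_connectedComponentIn hP.isClosed ?_ ⟨z, mem_connectedComponentIn hzC, hz⟩)
    exact Set.disjoint_left.2 fun x hx hx' => connectedComponentIn_subset _ _ hx (hC hx')
  -- For a base point outside the set, `connectedComponentIn` is empty.
  · rw [connectedComponentIn_eq_empty hzC]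
    exact Bornology.isBounded_empty

theorem not_isBounded_connectedComponentIn {P C : Set ℂ} (hCP : C ⊆ P) {z : ℂ} {t : Set ℂ}
    (htP : t ⊆ Pᶜ) (hzt : z ∈ t) (ht : IsPreconnected t) (htb : ¬ Bornology.IsBounded t) :
    ¬ Bornology.IsBounded (connectedComponentIn Cᶜ z) := fun h =>
  htb (h.subset (ht.subset_connectedComponentIn hzt
    (htP.trans (Set.compl_subset_compl.2 hCP))))

/-- A compact set without holes is recovered from any curve between its frontier and itself. -/
theorem enclosedRegion_outerCurve {P C : Set ℂ} (hP : IsCompact P) (hC : frontier P ⊆ C)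
    (hCP : C ⊆ P)
    (hesc : ∀ z ∉ P, ∃ t ⊆ Pᶜ, z ∈ t ∧ IsPreconnected t ∧ ¬ Bornology.IsBounded t) :
    enclosedRegion (outerCurve C) = P := by
  -- Then the outer curve is `frontier P`, and the same two arguments apply again with `frontier P`
  -- as the curve.
  have hext : exterior C = Pᶜ := by
    ext z
    constructor
    · rintro ⟨-, hz⟩ hzP
      exact hz (isBounded_connectedComponentIn_of_mem hP hC hzP)
    · intro hz
      obtain ⟨t, htP, hzt, ht, htb⟩ := hesc z hz
      exact ⟨fun h => hz (hCP h), not_isBounded_connectedComponentIn hCP htP hzt ht htb⟩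
  rw [outerCurve, hext, frontier_compl]
  ext z
  constructor
  · rintro (hz | hz)
    · exact hP.isClosed.frontier_subset hz
    · by_contra hzP
      obtain ⟨t, htP, hzt, ht, htb⟩ := hesc z hzP
      exact not_isBounded_connectedComponentIn hP.isClosed.frontier_subset htP hzt ht htb hz
  · intro hz
    exact Or.inr (isBounded_connectedComponentIn_of_mem hP subset_rfl hz)

end Topology

/-! ### Products of disks and escape to infinity -/

section Disks

theorem Disk_eq_closedBall (θ : ℝ) : Disk θ = Metric.closedBall ((1 - θ : ℝ) : ℂ) θ := by
  ext z
  rw [Metric.mem_closedBall, Complex.dist_eq]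
  rfl

theorem isCompact_Disk (θ : ℝ) : IsCompact (Disk θ) := by
  rw [Disk_eq_closedBall]
  exact isCompact_closedBall _ _

/-- In this form membership depends only on the modulus and the real part, and is visibly monotone
in the latter when θ ≤ 1. -/
theorem mem_Disk_iff {θ : ℝ} (hθ : 0 ≤ θ) (z : ℂ) :
    z ∈ Disk θ ↔ ‖z‖ ^ 2 - 2 * (1 - θ) * z.re + (1 - 2 * θ) ≤ 0 := by
  rw [Disk, Set.mem_ofPred_eq, ← sq_le_sq₀ (norm_nonneg _) hθ, Complex.sq_norm, Complex.sq_norm,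
    Complex.normSq_apply, Complex.normSq_apply]
  simp only [Complex.sub_re, Complex.sub_im, Complex.ofReal_re, Complex.ofReal_im]
  constructor <;> intro h <;> nlinarith

theorem one_mem_Disk {θ : ℝ} (hθ : 0 ≤ θ) : (1 : ℂ) ∈ Disk θ := by
  rw [mem_Disk_iff hθ]
  norm_num
  linarith

theorem mem_Disk_of_re_le {θ : ℝ} (hθ : 0 ≤ θ) (hθ' : θ ≤ 1) {z w : ℂ} (hz : z ∈ Disk θ)
    (hn : ‖w‖ = ‖z‖) (hre : z.re ≤ w.re) : w ∈ Disk θ := by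
  rw [mem_Disk_iff hθ] at *
  rw [hn]
  nlinarith

theorem norm_ofReal_mul_exp {r : ℝ} (hr : 0 ≤ r) (φ : ℝ) :
    ‖(r : ℂ) * Complex.exp (φ * Complex.I)‖ = r := by
  rw [norm_mul, Complex.norm_exp_ofReal_mul_I, mul_one, Complex.norm_real, Real.norm_of_nonneg hr]

theorem ofReal_mul_exp_re (r φ : ℝ) :
    ((r : ℂ) * Complex.exp (φ * Complex.I)).re = r * Real.cos φ := by
  rw [Complex.re_ofReal_mul, Complex.exp_ofReal_mul_I_re]

theorem exists_add_eq_of_abs_le {φ a b : ℝ} (ha : 0 ≤ a) (hb : 0 ≤ b) (h : |φ| ≤ a + b) :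
    ∃ φ₁ φ₂ : ℝ, φ = φ₁ + φ₂ ∧ |φ₁| ≤ a ∧ |φ₂| ≤ b := by
  rw [abs_le] at h
  -- Clamp φ to [-a, a]; the remainder has size at most b.
  refine ⟨max (-a) (min a φ), φ - max (-a) (min a φ), by ring, ?_, ?_⟩ <;> rw [abs_le] <;>
    constructor <;> grind

theorem mem_Disk_of_abs_le_arg {θ : ℝ} (hθ : 0 ≤ θ) (hθ' : θ ≤ 1) {z : ℂ} (hz : z ∈ Disk θ)
    {φ : ℝ} (hφ : |φ| ≤ |z.arg|) : (‖z‖ : ℂ) * Complex.exp (φ * Complex.I) ∈ Disk θ := by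
  refine mem_Disk_of_re_le hθ hθ' hz (norm_ofReal_mul_exp (norm_nonneg z) φ) ?_
  rw [ofReal_mul_exp_re, ← Complex.norm_mul_cos_arg z, ← Real.cos_abs φ, ← Real.cos_abs z.arg]
  exact mul_le_mul_of_nonneg_left (Real.cos_le_cos_of_nonneg_of_le_pi (abs_nonneg _)
    (Complex.abs_arg_le_pi z) hφ) (norm_nonneg z)

theorem abs_arg_le_of_re_le {z w : ℂ} (hz : z ≠ 0) (hn : ‖w‖ = ‖z‖) (hre : z.re ≤ w.re) :
    |w.arg| ≤ |z.arg| := by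
  have hpos : 0 < ‖z‖ := norm_pos_iff.2 hz
  by_contra! h
  have h1 := Real.cos_lt_cos_of_nonneg_of_le_pi (abs_nonneg _) (Complex.abs_arg_le_pi w) h
  rw [Real.cos_abs, Real.cos_abs] at h1
  have h2 := Complex.norm_mul_cos_arg z
  have h3 := Complex.norm_mul_cos_arg w
  rw [hn] at h3
  nlinarith

/-- Triangle inequality for the unoriented angles between zw, w and 1, which avoids reducing
arguments modulo 2π. -/
theorem abs_arg_mul_le {z w : ℂ} (hz : z ≠ 0) (hw : w ≠ 0) :
    |(z * w).arg| ≤ |z.arg| + |w.arg| := by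
  have h := InnerProductGeometry.angle_le_angle_add_angle (z * w) w (1 : ℂ)
  rwa [Complex.angle_eq_abs_arg (mul_ne_zero hz hw) one_ne_zero,
    Complex.angle_eq_abs_arg (mul_ne_zero hz hw) hw, Complex.angle_eq_abs_arg hw one_ne_zero,
    div_one, div_one, mul_div_cancel_right₀ _ hw] at h

variable {θ₁ θ₂ : ℝ}

/-- On a fixed circle about the origin, the product of the disks is closed under moving to the
right. -/
theorem mem_Disk_mul_Disk_of_re_le (hθ₁ : θ₁ ∈ Set.Ioo (0 : ℝ) 1) (hθ₂ : θ₂ ∈ Set.Ioo (0 : ℝ) 1)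
    {z w : ℂ} (hz : z ∈ Disk θ₁ * Disk θ₂) (hn : ‖w‖ = ‖z‖) (hre : z.re ≤ w.re) :
    w ∈ Disk θ₁ * Disk θ₂ := by
  obtain ⟨z₁, h₁, z₂, h₂, rfl⟩ := hz
  simp only at hn hre
  by_cases h0 : z₁ * z₂ = 0
  · have : w = z₁ * z₂ := by rw [h0] at hn ⊢; simpa using hn
    exact this ▸ Set.mul_mem_mul h₁ h₂
  · obtain ⟨φ₁, φ₂, hφ, hφ₁, hφ₂⟩ := exists_add_eq_of_abs_le (abs_nonneg _) (abs_nonneg _)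
      ((abs_arg_le_of_re_le h0 hn hre).trans
        (abs_arg_mul_le (left_ne_zero_of_mul h0) (right_ne_zero_of_mul h0)))
    refine ⟨_, mem_Disk_of_abs_le_arg hθ₁.1.le hθ₁.2.le h₁ hφ₁, _,
      mem_Disk_of_abs_le_arg hθ₂.1.le hθ₂.2.le h₂ hφ₂, ?_⟩
    simp only
    conv_rhs => rw [← Complex.norm_mul_exp_arg_mul_I w, hn, hφ, norm_mul]
    push_cast
    rw [add_mul, Complex.exp_add]
    ring

/-- A point of the disk with nonpositive real part forces θ ≥ 1/2, so the disk contains 0 and, being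
convex, the segment from 0 to z. -/
theorem smul_mem_Disk {θ : ℝ} (hθ : θ ∈ Set.Ioo (0 : ℝ) 1) {z : ℂ} (hz : z ∈ Disk θ)
    (hre : z.re ≤ 0) {t : ℝ} (ht : t ∈ Set.Icc (0 : ℝ) 1) : (t : ℂ) * z ∈ Disk θ := by
  rw [mem_Disk_iff hθ.1.le] at *
  rw [norm_mul, Complex.norm_real, Real.norm_of_nonneg ht.1, Complex.re_ofReal_mul]
  have h1 : 0 ≤ -(2 * (1 - θ) * z.re) := by nlinarith [hθ.2]
  have h2 : t ^ 2 * ‖z‖ ^ 2 ≤ t * ‖z‖ ^ 2 :=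
    mul_le_mul_of_nonneg_right (by nlinarith [ht.1, ht.2]) (sq_nonneg _)
  have h3 : (1 - 2 * θ) ≤ 0 := by nlinarith [sq_nonneg ‖z‖]
  nlinarith [ht.1, ht.2]

theorem neg_ofReal_mem_Disk_mul_Disk (hθ₁ : θ₁ ∈ Set.Ioo (0 : ℝ) 1)
    (hθ₂ : θ₂ ∈ Set.Ioo (0 : ℝ) 1) {r s : ℝ} (hr : 0 ≤ r) (hrs : r ≤ s)
    (hs : -(s : ℂ) ∈ Disk θ₁ * Disk θ₂) : -(r : ℂ) ∈ Disk θ₁ * Disk θ₂ := by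
  rcases (hr.trans hrs).eq_or_lt with rfl | hs0
  · rwa [le_antisymm hrs hr]
  obtain ⟨z₁, h₁, z₂, h₂, h⟩ := hs
  simp only at h
  have ht : r / s ∈ Set.Icc (0 : ℝ) 1 := ⟨by positivity, (div_le_one hs0).2 hrs⟩
  have hr' : -(r : ℂ) = ((r / s : ℝ) : ℂ) * (z₁ * z₂) := by
    have : (s : ℂ) ≠ 0 := by exact_mod_cast hs0.ne'
    rw [h]
    push_cast
    field_simp
  -- Two numbers in the open right half-plane cannot have a negative real product; the factor
  -- outside it is the one to shrink.
  have hsign : z₁.re ≤ 0 ∨ z₂.re ≤ 0 := by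
    have hre := congrArg Complex.re h
    have him := congrArg Complex.im h
    simp only [Complex.mul_re, Complex.mul_im, Complex.neg_re, Complex.neg_im,
      Complex.ofReal_re, Complex.ofReal_im, neg_zero] at hre him
    by_contra! hpos
    have h3 : 0 < z₁.re * z₂.re := mul_pos hpos.1 hpos.2
    have h4 : 0 < z₁.im * z₂.im := by linarith
    have h5 : z₁.re * z₂.re * (z₁.im * z₂.im) = -(z₁.re * z₂.im) ^ 2 := by
      linear_combination (z₁.re * z₂.im) * him
    nlinarith [mul_pos h3 h4, sq_nonneg (z₁.re * z₂.im)]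
  rw [hr']
  rcases hsign with hneg | hneg
  · rw [← mul_assoc]
    exact Set.mul_mem_mul (smul_mem_Disk hθ₁ h₁ hneg ht) h₂
  · rw [mul_left_comm]
    exact Set.mul_mem_mul h₁ (smul_mem_Disk hθ₂ h₂ hneg ht)

/-- Rotate z on its circle to the negative axis, then follow that axis to -∞. The real part
decreases along the arc, so re-entering the product would put z in it; re-entering on the ray would
put -|z| in it. -/
theorem exists_escape (hθ₁ : θ₁ ∈ Set.Ioo (0 : ℝ) 1)
    (hθ₂ : θ₂ ∈ Set.Ioo (0 : ℝ) 1) {z : ℂ} (hz : z ∉ Disk θ₁ * Disk θ₂) :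
    ∃ t ⊆ (Disk θ₁ * Disk θ₂)ᶜ, z ∈ t ∧ IsPreconnected t ∧ ¬ Bornology.IsBounded t := by
  -- The sign selects the half-plane of z, so that the angle can run from |arg z| up to π.
  obtain ⟨σ, hσ, hσz⟩ : ∃ σ : ℝ, (σ = 1 ∨ σ = -1) ∧ z.arg = σ * |z.arg| := by
    rcases abs_choice z.arg with h | h
    · exact ⟨1, Or.inl rfl, by rw [h, one_mul]⟩
    · exact ⟨-1, Or.inr rfl, by rw [h]; ring⟩
  have hcos : ∀ φ : ℝ, Real.cos (σ * φ) = Real.cos φ := by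
    rcases hσ with rfl | rfl <;> simp
  have hpi : Complex.exp ((σ * Real.pi : ℝ) * Complex.I) = -1 := by
    rcases hσ with rfl | rfl
    · simp
    · simp [Complex.exp_neg]
  set f : ℝ → ℂ := fun φ => (‖z‖ : ℂ) * Complex.exp ((σ * φ : ℝ) * Complex.I) with hf
  have harc : ∀ φ ∈ Set.Icc |z.arg| Real.pi, f φ ∉ Disk θ₁ * Disk θ₂ := by
    intro φ hφ hmem
    refine hz (mem_Disk_mul_Disk_of_re_le hθ₁ hθ₂ hmem
      (norm_ofReal_mul_exp (norm_nonneg z) _).symm ?_)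
    rw [hf, ofReal_mul_exp_re, ← Complex.norm_mul_cos_arg z, hcos, ← Real.cos_abs z.arg]
    exact mul_le_mul_of_nonneg_left
      (Real.cos_le_cos_of_nonneg_of_le_pi (abs_nonneg _) hφ.2 hφ.1) (norm_nonneg z)
  have hfpi : f Real.pi = -((‖z‖ : ℝ) : ℂ) := by simp only [hf]; rw [hpi]; ring
  have hfz : f |z.arg| = z := by
    simp only [hf]; rw [← hσz, Complex.norm_mul_exp_arg_mul_I]
  have hIcc : |z.arg| ≤ Real.pi := Complex.abs_arg_le_pi z
  refine ⟨f '' Set.Icc |z.arg| Real.pi ∪ (fun s : ℝ => -(s : ℂ)) '' Set.Ici ‖z‖, ?_, ?_, ?_, ?_⟩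
  · rintro _ (⟨φ, hφ, rfl⟩ | ⟨s, hs, rfl⟩)
    · exact harc φ hφ
    · exact fun h => harc Real.pi ⟨hIcc, le_rfl⟩
        (hfpi ▸ neg_ofReal_mem_Disk_mul_Disk hθ₁ hθ₂ (norm_nonneg z) hs h)
  · exact Or.inl ⟨_, ⟨le_rfl, hIcc⟩, hfz⟩
  · refine IsPreconnected.union (f Real.pi) ⟨_, ⟨hIcc, le_rfl⟩, rfl⟩
      ⟨‖z‖, Set.self_mem_Ici, hfpi.symm⟩ ?_ ?_
    · exact isPreconnected_Icc.image _ (by fun_prop)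
    · exact isPreconnected_Ici.image _ (by fun_prop)
  · intro hb
    obtain ⟨C, hC⟩ := isBounded_iff_forall_norm_le.1 hb
    have := hC _ (Or.inr ⟨max ‖z‖ (C + 1), Set.mem_Ici.2 (le_max_left _ _), rfl⟩)
    rw [norm_neg, Complex.norm_real] at this
    linarith [le_abs_self (max ‖z‖ (C + 1)), Real.norm_eq_abs (max ‖z‖ (C + 1)),
      le_max_right ‖z‖ (C + 1)]

end Disks
end SRG

namespace SRG
-- The product of disks and the Cartesian oval
section Oval

variable {θ₁ θ₂ : ℝ}

/-- The defining function of the outer branch of the Cartesian oval. -/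
noncomputable def ovalFun (θ₁ θ₂ : ℝ) (z : ℂ) : ℝ :=
  ‖z‖ ^ 2 - 2 * (1 - θ₁) * (1 - θ₂) * z.re + (1 - 2 * θ₁) * (1 - 2 * θ₂) - 2 * θ₁ * θ₂ * ‖z‖

theorem mem_cartesianOval_of_ovalFun_eq_zero {z : ℂ} (hz : ovalFun θ₁ θ₂ z = 0) :
    z ∈ cartesianOval θ₁ θ₂ := by
  refine ⟨‖z‖, z.arg, (Complex.norm_mul_exp_arg_mul_I z).symm, ?_⟩
  rw [← hz, ovalFun, ← Complex.norm_mul_cos_arg z]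
  ring

/-- Only the term 2rθ₁θ₂ sees the sign of r, and replacing r by |r| there can only lower the value.
-/
theorem ovalFun_nonpos_of_mem_cartesianOval (hθ₁ : 0 ≤ θ₁) (hθ₂ : 0 ≤ θ₂) {z : ℂ}
    (hz : z ∈ cartesianOval θ₁ θ₂) : ovalFun θ₁ θ₂ z ≤ 0 := by
  obtain ⟨r, φ, rfl, h⟩ := hz
  have hn : ‖(r : ℂ) * Complex.exp (φ * Complex.I)‖ = |r| := by
    rw [norm_mul, Complex.norm_exp_ofReal_mul_I, mul_one, Complex.norm_real, Real.norm_eq_abs]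
  rw [ovalFun, hn, ofReal_mul_exp_re, sq_abs]
  have := mul_le_mul_of_nonneg_left (le_abs_self r) (mul_nonneg hθ₁ hθ₂)
  linarith

theorem mem_Disk_mul_Disk_iff_exists (hθ₂ : 0 ≤ θ₂) (z : ℂ) :
    z ∈ Disk θ₁ * Disk θ₂ ↔ ∃ w ∈ Disk θ₁, ‖z - (1 - θ₂ : ℝ) * w‖ ≤ θ₂ * ‖w‖ := by
  constructor
  · rintro ⟨w, hw, w', hw', rfl⟩
    refine ⟨w, hw, ?_⟩
    have : w * w' - (1 - θ₂ : ℝ) * w = (w' - ((1 - θ₂ : ℝ) : ℂ)) * w := by ring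
    simp only
    rw [this, norm_mul]
    exact mul_le_mul_of_nonneg_right hw' (norm_nonneg _)
  · rintro ⟨w, hw, h⟩
    by_cases h0 : w = 0
    · subst h0
      have hz : z = 0 := by simpa using h
      exact ⟨0, hw, 1, one_mem_Disk hθ₂, by simp [hz]⟩
    · refine ⟨w, hw, z / w, ?_, mul_div_cancel₀ _ h0⟩
      have : z / w - ((1 - θ₂ : ℝ) : ℂ) = (z - (1 - θ₂ : ℝ) * w) / w := by field_simp
      rw [Disk, Set.mem_ofPred_eq, this, norm_div]
      exact (div_le_iff₀ (norm_pos_iff.2 h0)).2 h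

/-- Apollonius: the condition on w is rewritten around a centre depending on z, using (1 - θ₂)² -
θ₂² = 1 - 2θ₂. -/
theorem norm_sub_sq_sub_sq (θ₂ : ℝ) (z w : ℂ) :
    ‖((1 - 2 * θ₂ : ℝ) : ℂ) * w - (1 - θ₂ : ℝ) * z‖ ^ 2 - (θ₂ * ‖z‖) ^ 2 =
      (1 - 2 * θ₂) * (‖z - (1 - θ₂ : ℝ) * w‖ ^ 2 - (θ₂ * ‖w‖) ^ 2) := by
  simp only [mul_pow, Complex.sq_norm, Complex.normSq_apply, Complex.sub_re, Complex.sub_im,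
    Complex.re_ofReal_mul, Complex.im_ofReal_mul]
  ring

theorem norm_sub_sq_sub_sq_eq_mul_ovalFun (θ₁ θ₂ : ℝ) (z : ℂ) :
    ‖((1 - 2 * θ₂ : ℝ) : ℂ) * (1 - θ₁ : ℝ) - (1 - θ₂ : ℝ) * z‖ ^ 2
        - (θ₂ * ‖z‖ + (1 - 2 * θ₂) * θ₁) ^ 2 = (1 - 2 * θ₂) * ovalFun θ₁ θ₂ z := by
  have h : ‖((1 - 2 * θ₂ : ℝ) : ℂ) * (1 - θ₁ : ℝ) - (1 - θ₂ : ℝ) * z‖ ^ 2 =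
      (1 - θ₂) ^ 2 * ‖z‖ ^ 2 - 2 * (1 - 2 * θ₂) * (1 - θ₁) * (1 - θ₂) * z.re
        + (1 - 2 * θ₂) ^ 2 * (1 - θ₁) ^ 2 := by
    simp only [Complex.sq_norm, Complex.normSq_apply, Complex.sub_re, Complex.sub_im,
      Complex.re_ofReal_mul, Complex.im_ofReal_mul, Complex.ofReal_re, Complex.ofReal_im]
    ring
  rw [h, ovalFun]
  ring

/-- After scaling w by 1 - 2θ₂ > 0, two closed balls have to meet: the distance of the centres is at
most the sum of the radii. -/
theorem mem_Disk_mul_Disk_iff_of_lt (hθ₁ : 0 ≤ θ₁) (hθ₂ : 0 ≤ θ₂) (h : θ₂ < 1 / 2) (z : ℂ) :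
    z ∈ Disk θ₁ * Disk θ₂ ↔ ‖((1 - 2 * θ₂ : ℝ) : ℂ) * (1 - θ₁ : ℝ) - (1 - θ₂ : ℝ) * z‖
      ≤ θ₂ * ‖z‖ + (1 - 2 * θ₂) * θ₁ := by
  set k := 1 - 2 * θ₂ with hk
  have hkpos : 0 < k := by linarith
  have hk0 : (k : ℂ) ≠ 0 := by exact_mod_cast hkpos.ne'
  have key : ∀ w : ℂ, ‖z - (1 - θ₂ : ℝ) * w‖ ≤ θ₂ * ‖w‖ ↔
      ‖(k : ℂ) * w - (1 - θ₂ : ℝ) * z‖ ≤ θ₂ * ‖z‖ := by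
    intro w
    rw [← sq_le_sq₀ (norm_nonneg _) (by positivity), ← sq_le_sq₀ (norm_nonneg _) (by positivity)]
    have := norm_sub_sq_sub_sq θ₂ z w
    rw [← hk] at this
    constructor <;> intro h' <;> nlinarith
  rw [mem_Disk_mul_Disk_iff_exists hθ₂]
  simp only [key]
  constructor
  · rintro ⟨w, hw, h'⟩
    have e : (k : ℂ) * (1 - θ₁ : ℝ) - (1 - θ₂ : ℝ) * z =
        ((k : ℂ) * w - (1 - θ₂ : ℝ) * z) - k * (w - (1 - θ₁ : ℝ)) := by ring
    rw [e]
    refine (norm_sub_le _ _).trans (add_le_add h' ?_)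
    rw [norm_mul, Complex.norm_real, Real.norm_of_nonneg hkpos.le]
    exact mul_le_mul_of_nonneg_left hw hkpos.le
  · intro h'
    obtain ⟨y, hy, hy'⟩ := exists_dist_le_le (x := (k : ℂ) * (1 - θ₁ : ℝ))
      (z := ((1 - θ₂ : ℝ) : ℂ) * z) (mul_nonneg hkpos.le hθ₁)
      (mul_nonneg hθ₂ (norm_nonneg z)) (by rwa [Complex.dist_eq])
    rw [Complex.dist_eq] at hy hy'
    refine ⟨y / k, ?_, by rwa [mul_div_cancel₀ _ hk0]⟩
    have e : y / k - (1 - θ₁ : ℝ) = -((k : ℂ) * (1 - θ₁ : ℝ) - y) / k := by field_simp; ring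
    rw [Disk, Set.mem_ofPred_eq, e, norm_div, norm_neg, Complex.norm_real,
      Real.norm_of_nonneg hkpos.le, div_le_iff₀ hkpos]
    linarith

/-- Now w must avoid an open ball, so the farthest point of `Disk θ₁` from its centre decides. The
left side of the criterion can be negative, so squaring it would not give an equivalent condition.
-/
theorem mem_Disk_mul_Disk_iff_of_gt (hθ₁ : 0 ≤ θ₁) (h : 1 / 2 < θ₂) (z : ℂ) :
    z ∈ Disk θ₁ * Disk θ₂ ↔ θ₂ * ‖z‖ + (1 - 2 * θ₂) * θ₁ ≤
      ‖((1 - 2 * θ₂ : ℝ) : ℂ) * (1 - θ₁ : ℝ) - (1 - θ₂ : ℝ) * z‖ := by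
  set k := 1 - 2 * θ₂ with hk
  have hθ₂ : 0 ≤ θ₂ := by linarith
  have hkneg : k < 0 := by linarith
  have key : ∀ w : ℂ, ‖z - (1 - θ₂ : ℝ) * w‖ ≤ θ₂ * ‖w‖ ↔
      θ₂ * ‖z‖ ≤ ‖(k : ℂ) * w - (1 - θ₂ : ℝ) * z‖ := by
    intro w
    rw [← sq_le_sq₀ (norm_nonneg _) (by positivity), ← sq_le_sq₀ (by positivity) (norm_nonneg _)]
    have := norm_sub_sq_sub_sq θ₂ z w
    rw [← hk] at this
    constructor <;> intro h' <;> nlinarith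
  rw [mem_Disk_mul_Disk_iff_exists hθ₂]
  simp only [key]
  constructor
  · rintro ⟨w, hw, h'⟩
    have e : (k : ℂ) * w - (1 - θ₂ : ℝ) * z =
        ((k : ℂ) * (1 - θ₁ : ℝ) - (1 - θ₂ : ℝ) * z) + k * (w - (1 - θ₁ : ℝ)) := by ring
    have h2 : ‖(k : ℂ) * (w - (1 - θ₁ : ℝ))‖ ≤ -k * θ₁ := by
      rw [norm_mul, Complex.norm_real, Real.norm_of_nonpos hkneg.le]
      exact mul_le_mul_of_nonneg_left hw (by linarith)
    rw [e] at h'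
    linarith [norm_add_le ((k : ℂ) * (1 - θ₁ : ℝ) - (1 - θ₂ : ℝ) * z) (k * (w - (1 - θ₁ : ℝ)))]
  · intro h'
    set v : ℂ := (k : ℂ) * (1 - θ₁ : ℝ) - (1 - θ₂ : ℝ) * z with hv
    obtain ⟨u, hu, huv⟩ : ∃ u : ℂ, ‖u‖ = 1 ∧ v = ‖v‖ * u := by
      refine ⟨Complex.exp (v.arg * Complex.I), Complex.norm_exp_ofReal_mul_I _,
        (Complex.norm_mul_exp_arg_mul_I v).symm⟩
    -- The farthest point: as k < 0, the shift by -θ₁u lengthens v by -kθ₁.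
    refine ⟨(1 - θ₁ : ℝ) - θ₁ * u, ?_, ?_⟩
    · rw [Disk, Set.mem_ofPred_eq, sub_sub_cancel_left, norm_neg, norm_mul, hu, mul_one,
        Complex.norm_real, Real.norm_of_nonneg hθ₁]
    · have e : (k : ℂ) * ((1 - θ₁ : ℝ) - θ₁ * u) - (1 - θ₂ : ℝ) * z =
          ((‖v‖ + -k * θ₁ : ℝ) : ℂ) * u := by
        have : (k : ℂ) * ((1 - θ₁ : ℝ) - θ₁ * u) - (1 - θ₂ : ℝ) * z = v - k * θ₁ * u := by
          rw [hv]; ring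
        rw [this]
        nth_rw 1 [huv]
        push_cast
        ring
      rw [e, norm_mul, hu, mul_one, Complex.norm_real, Real.norm_eq_abs]
      exact le_trans (by linarith) (le_abs_self _)

theorem mem_Disk_mul_Disk_iff_of_eq (hθ₁ : 0 ≤ θ₁) (h : θ₂ = 1 / 2) (z : ℂ) :
    z ∈ Disk θ₁ * Disk θ₂ ↔ ovalFun θ₁ θ₂ z ≤ 0 := by
  have hθ₂ : 0 ≤ θ₂ := by linarith
  have key : ∀ w : ℂ, ‖z - (1 - θ₂ : ℝ) * w‖ ≤ θ₂ * ‖w‖ ↔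
      ‖z‖ ^ 2 ≤ z.re * w.re + z.im * w.im := by
    intro w
    rw [← sq_le_sq₀ (norm_nonneg _) (by positivity), mul_pow, Complex.sq_norm, Complex.sq_norm,
      Complex.sq_norm, Complex.normSq_apply, Complex.normSq_apply, Complex.normSq_apply]
    simp only [Complex.sub_re, Complex.sub_im, Complex.re_ofReal_mul, Complex.im_ofReal_mul]
    subst h
    constructor <;> intro h' <;> nlinarith
  have hF : ovalFun θ₁ θ₂ z ≤ 0 ↔ ‖z‖ ^ 2 ≤ (1 - θ₁) * z.re + θ₁ * ‖z‖ := by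
    subst h
    rw [ovalFun]
    constructor <;> intro h' <;> linarith
  rw [mem_Disk_mul_Disk_iff_exists hθ₂, hF]
  simp only [key]
  constructor
  · rintro ⟨w, hw, h'⟩
    have h1 := Complex.re_le_norm ((w - (1 - θ₁ : ℝ)) * (starRingEnd ℂ) z)
    rw [norm_mul, Complex.norm_conj] at h1
    simp only [Complex.mul_re, Complex.sub_re, Complex.sub_im, Complex.ofReal_re,
      Complex.ofReal_im, Complex.conj_re, Complex.conj_im] at h1
    have h2 : ‖w - ((1 - θ₁ : ℝ) : ℂ)‖ * ‖z‖ ≤ θ₁ * ‖z‖ :=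
      mul_le_mul_of_nonneg_right hw (norm_nonneg z)
    linarith
  · intro h'
    -- The point of `Disk θ₁` farthest in the direction of z maximizes the inner product with z.
    refine ⟨(1 - θ₁ : ℝ) + θ₁ * Complex.exp (z.arg * Complex.I), ?_, ?_⟩
    · rw [Disk, Set.mem_ofPred_eq, add_sub_cancel_left, norm_ofReal_mul_exp hθ₁]
    · simp only [Complex.add_re, Complex.add_im, Complex.re_ofReal_mul, Complex.im_ofReal_mul,
        Complex.ofReal_re, Complex.ofReal_im, Complex.exp_ofReal_mul_I_re,
        Complex.exp_ofReal_mul_I_im]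
      have h3 : z.re * Real.cos z.arg + z.im * Real.sin z.arg = ‖z‖ := by
        rw [← Complex.norm_mul_cos_arg z, ← Complex.norm_mul_sin_arg z]
        linear_combination ‖z‖ * Real.cos_sq_add_sin_sq z.arg
      have h4 := congrArg (θ₁ * ·) h3
      linarith

theorem cartesianOval_subset (hθ₁ : 0 ≤ θ₁) (hθ₂ : 0 ≤ θ₂) :
    cartesianOval θ₁ θ₂ ⊆ Disk θ₁ * Disk θ₂ := by
  intro z hz
  have hF := ovalFun_nonpos_of_mem_cartesianOval hθ₁ hθ₂ hz
  have hid := norm_sub_sq_sub_sq_eq_mul_ovalFun θ₁ θ₂ z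
  rcases lt_trichotomy θ₂ (1 / 2) with h | h | h
  · rw [mem_Disk_mul_Disk_iff_of_lt hθ₁ hθ₂ h]
    have hk : 0 ≤ 1 - 2 * θ₂ := by linarith
    refine le_of_abs_le (abs_le_of_sq_le_sq ?_ (by positivity))
    nlinarith
  · exact (mem_Disk_mul_Disk_iff_of_eq hθ₁ h z).2 hF
  · rw [mem_Disk_mul_Disk_iff_of_gt hθ₁ h]
    refine le_of_abs_le (abs_le_of_sq_le_sq ?_ (norm_nonneg _))
    nlinarith

theorem frontier_Disk_mul_Disk_subset (hθ₁ : 0 ≤ θ₁) (hθ₂ : 0 ≤ θ₂) :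
    frontier (Disk θ₁ * Disk θ₂) ⊆ cartesianOval θ₁ θ₂ := by
  intro z hz
  apply mem_cartesianOval_of_ovalFun_eq_zero
  have hid := norm_sub_sq_sub_sq_eq_mul_ovalFun θ₁ θ₂ z
  let L : ℂ → ℝ := fun z => ‖((1 - 2 * θ₂ : ℝ) : ℂ) * (1 - θ₁ : ℝ) - (1 - θ₂ : ℝ) * z‖
  let R : ℂ → ℝ := fun z => θ₂ * ‖z‖ + (1 - 2 * θ₂) * θ₁
  have hL : Continuous L := by fun_prop
  have hR : Continuous R := by fun_prop
  rcases lt_trichotomy θ₂ (1 / 2) with h | h | h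
  · have he : Disk θ₁ * Disk θ₂ = {z | L z ≤ R z} :=
      Set.ext (mem_Disk_mul_Disk_iff_of_lt hθ₁ hθ₂ h)
    rw [he] at hz
    have : L z = R z := frontier_le_subset_eq hL hR hz
    simp only [L, R] at this
    rw [this, sub_self] at hid
    exact (mul_eq_zero.1 hid.symm).resolve_left (by linarith)
  · have he : Disk θ₁ * Disk θ₂ = {z | ovalFun θ₁ θ₂ z ≤ 0} :=
      Set.ext (mem_Disk_mul_Disk_iff_of_eq hθ₁ h)
    rw [he] at hz
    exact frontier_le_subset_eq (by unfold ovalFun; fun_prop) continuous_const hz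
  · have he : Disk θ₁ * Disk θ₂ = {z | R z ≤ L z} :=
      Set.ext (mem_Disk_mul_Disk_iff_of_gt hθ₁ h)
    rw [he] at hz
    have : R z = L z := frontier_le_subset_eq hR hL hz
    simp only [L, R] at this
    rw [this, sub_self] at hid
    exact (mul_eq_zero.1 hid.symm).resolve_left (by linarith)

theorem Disk_mul_Disk_eq_enclosedRegion (hθ₁ : θ₁ ∈ Set.Ioo (0 : ℝ) 1)
    (hθ₂ : θ₂ ∈ Set.Ioo (0 : ℝ) 1) :
    Disk θ₁ * Disk θ₂ = enclosedRegion (outerCurve (cartesianOval θ₁ θ₂)) :=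
  (enclosedRegion_outerCurve ((isCompact_Disk θ₁).mul (isCompact_Disk θ₂))
    (frontier_Disk_mul_Disk_subset hθ₁.1.le hθ₂.1.le)
    (cartesianOval_subset hθ₁.1.le hθ₂.1.le) fun _ hz => exists_escape hθ₁ hθ₂ hz).symm

end Oval
end SRG

namespace SRG
-- Relative graphs of compositions lie in the product
section Angles

variable {H : Type*} [NormedAddCommGroup H] [InnerProductSpace ℝ H] {θ₁ θ₂ θ : ℝ}

theorem angle_nonneg (a b : H) : 0 ≤ angle a b := by
  unfold angle
  split_ifs
  exacts [Real.arccos_nonneg _, le_rfl]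

/-- The two conventions differ only when a vector vanishes: 0 here, π/2 in Mathlib. -/
theorem angle_le_inner_angle (a b : H) : angle a b ≤ InnerProductGeometry.angle a b := by
  unfold angle
  split_ifs
  exacts [le_rfl, InnerProductGeometry.angle_nonneg _ _]

theorem mem_Disk_of_norm_sub_smul_le (hθ : θ ∈ Set.Ioo (0 : ℝ) 1) {a d : H} (hd : d ≠ 0)
    (h : ‖a - (1 - θ) • d‖ ≤ θ * ‖d‖) {φ : ℝ} (hφ : |φ| ≤ InnerProductGeometry.angle a d) :
    ((‖a‖ / ‖d‖ : ℝ) : ℂ) * Complex.exp (φ * Complex.I) ∈ Disk θ := by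
  have hd' : 0 < ‖d‖ := norm_pos_iff.2 hd
  rw [mem_Disk_iff hθ.1.le, norm_ofReal_mul_exp (by positivity), ofReal_mul_exp_re]
  have hcos : inner ℝ a d ≤ ‖a‖ * ‖d‖ * Real.cos φ := by
    rw [← InnerProductGeometry.cos_angle_mul_norm_mul_norm, mul_comm, ← Real.cos_abs φ]
    exact mul_le_mul_of_nonneg_left (Real.cos_le_cos_of_nonneg_of_le_pi (abs_nonneg _)
      (InnerProductGeometry.angle_le_pi _ _) hφ) (by positivity)
  have hsq : ‖a‖ ^ 2 - 2 * (1 - θ) * inner ℝ a d + (1 - 2 * θ) * ‖d‖ ^ 2 ≤ 0 := by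
    rw [← sq_le_sq₀ (norm_nonneg _) (mul_nonneg hθ.1.le hd'.le), norm_sub_sq_real,
      inner_smul_right, norm_smul, Real.norm_of_nonneg (by linarith [hθ.2])] at h
    linarith
  have e : (‖a‖ / ‖d‖) ^ 2 - 2 * (1 - θ) * (‖a‖ / ‖d‖ * Real.cos φ) + (1 - 2 * θ) =
      (‖a‖ ^ 2 - 2 * (1 - θ) * (‖a‖ * ‖d‖ * Real.cos φ) + (1 - 2 * θ) * ‖d‖ ^ 2) / ‖d‖ ^ 2 := by
    field_simp
  rw [e]
  refine div_nonpos_of_nonpos_of_nonneg ?_ (by positivity)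
  have := mul_le_mul_of_nonneg_left hcos (by linarith [hθ.2] : 0 ≤ 2 * (1 - θ))
  linarith

/-- Multiplicativity of relative graphs of disks: if `a` is related to `b` by `Disk θ₁` and `b` to
`d` by `Disk θ₂`, then `a` is related to `d` by the product. -/
theorem mem_Disk_mul_Disk_of_norm_sub_smul_le (hθ₁ : θ₁ ∈ Set.Ioo (0 : ℝ) 1)
    (hθ₂ : θ₂ ∈ Set.Ioo (0 : ℝ) 1) {a b d : H} (hd : d ≠ 0)
    (hab : ‖a - (1 - θ₁) • b‖ ≤ θ₁ * ‖b‖) (hbd : ‖b - (1 - θ₂) • d‖ ≤ θ₂ * ‖d‖)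
    {φ : ℝ} (hφ : |φ| ≤ angle a d) :
    ((‖a‖ / ‖d‖ : ℝ) : ℂ) * Complex.exp (φ * Complex.I) ∈ Disk θ₁ * Disk θ₂ := by
  -- If b = 0 then a = 0 and the target is 0; the second factor is already 0, so any first factor
  -- serves.
  by_cases hb : b = 0
  · have ha : a = 0 := by simpa [hb] using hab
    have h0 := mem_Disk_of_norm_sub_smul_le hθ₂ hd hbd (φ := 0)
      (by simpa using InnerProductGeometry.angle_nonneg b d)
    refine ⟨1, one_mem_Disk hθ₁.1.le, _, h0, ?_⟩
    simp [ha, hb]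
  · obtain ⟨φ₁, φ₂, rfl, h₁, h₂⟩ := exists_add_eq_of_abs_le
      (InnerProductGeometry.angle_nonneg a b) (InnerProductGeometry.angle_nonneg b d)
      ((hφ.trans (angle_le_inner_angle a d)).trans
        (InnerProductGeometry.angle_le_angle_add_angle a b d))
    refine ⟨_, mem_Disk_of_norm_sub_smul_le hθ₁ hb hab h₁, _,
      mem_Disk_of_norm_sub_smul_le hθ₂ hd hbd h₂, ?_⟩
    have hb' : (‖b‖ : ℂ) ≠ 0 := by exact_mod_cast norm_ne_zero_iff.2 hb
    simp only
    push_cast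
    rw [add_mul, Complex.exp_add]
    field_simp

theorem exists_eq_singleton_of_mem_averaged {A : Operator H} (hA : A ∈ averaged H θ)
    (hθ : 0 ≤ θ) :
    ∃ f : H → H, (∀ x, A x = {f x}) ∧
      ∀ x y, ‖(f x - f y) - (1 - θ) • (x - y)‖ ≤ θ * ‖x - y‖ := by
  obtain ⟨N, hN, hA⟩ := hA
  refine ⟨_, hA, fun x y => ?_⟩
  have e : ((1 - θ) • x + θ • N x - ((1 - θ) • y + θ • N y)) - (1 - θ) • (x - y) =
      θ • (N x - N y) := by module
  rw [e, norm_smul, Real.norm_of_nonneg hθ]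
  exact mul_le_mul_of_nonneg_left (hN x y) hθ

theorem comp_apply_of_eq_singleton {X : Type*} {A B : Operator X} {f g : X → X} (hA : ∀ x, A x = {f x})
    (hB : ∀ x, B x = {g x}) (x : X) : A.comp B x = {f (g x)} := by
  ext z
  simp [Operator.comp, hA, hB]

theorem srgClass_subset (hθ₁ : θ₁ ∈ Set.Ioo (0 : ℝ) 1) (hθ₂ : θ₂ ∈ Set.Ioo (0 : ℝ) 1) :
    srgClass (compClass (averaged H θ₁) (averaged H θ₂)) ⊆
      (fun z : ℂ => (z : OnePoint ℂ)) '' (Disk θ₁ * Disk θ₂) := by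
  intro w hw
  simp only [srgClass, Set.mem_iUnion] at hw
  obtain ⟨T, ⟨A, hA, B, hB, rfl⟩, hw⟩ := hw
  obtain ⟨f, hAf, hf⟩ := exists_eq_singleton_of_mem_averaged hA hθ₁.1.le
  obtain ⟨g, hBg, hg⟩ := exists_eq_singleton_of_mem_averaged hB hθ₂.1.le
  have hT := comp_apply_of_eq_singleton hAf hBg
  rcases hw with ⟨x, y, u, v, hu, hv, hxy, s, hs, rfl⟩ | ⟨-, x, hx⟩
  · rw [hT, Set.mem_singleton_iff] at hu hv
    subst hu hv
    refine ⟨_, mem_Disk_mul_Disk_of_norm_sub_smul_le hθ₁ hθ₂ (sub_ne_zero.2 hxy)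
      (hf (g x) (g y)) (hg x y)
      (φ := s * angle (f (g x) - f (g y)) (x - y)) ?_, ?_⟩
    · have hs' : |s| = 1 := by rcases hs with rfl | rfl <;> simp
      rw [abs_mul, hs', one_mul, abs_of_nonneg (angle_nonneg _ _)]
    · push_cast
      rfl
  · rw [hT] at hx
    exact absurd hx Set.not_nontrivial_singleton

end Angles

/-! ### Realizing every product on a plane -/

section Plane

variable {H : Type*} [NormedAddCommGroup H] [InnerProductSpace ℝ H] {θ₁ θ₂ θ : ℝ}

theorem exists_orthonormal_pair (h : 2 ≤ Module.rank ℝ H) :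
    ∃ e₀ e₁ : H, ‖e₀‖ = 1 ∧ ‖e₁‖ = 1 ∧ inner ℝ e₀ e₁ = 0 := by
  obtain ⟨s, hs, hli⟩ := le_rank_iff_exists_linearIndependent.1 h
  obtain ⟨σ⟩ : Nonempty (Fin 2 ≃ s) := by
    rw [← Cardinal.lift_mk_eq', hs]
    simp
  have ho := InnerProductSpace.gramSchmidtNormed_orthonormal (hli.comp σ σ.injective)
  exact ⟨_, _, ho.1 0, ho.1 1, ho.2 (by decide)⟩

/-- The embedding of the complex plane along two vectors. -/
def planeEmb (e₀ e₁ : H) : ℂ →ₗ[ℝ] H :=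
  Complex.reLm.smulRight e₀ + Complex.imLm.smulRight e₁

/-- The coordinates of a vector along two vectors, as a complex number. -/
noncomputable def planeProj (e₀ e₁ : H) (x : H) : ℂ := ⟨inner ℝ e₀ x, inner ℝ e₁ x⟩

variable {e₀ e₁ : H}

theorem planeEmb_apply (z : ℂ) : planeEmb e₀ e₁ z = z.re • e₀ + z.im • e₁ := rfl

theorem planeProj_sub (x y : H) :
    planeProj e₀ e₁ x - planeProj e₀ e₁ y = planeProj e₀ e₁ (x - y) := by
  apply Complex.ext <;> simp [planeProj, inner_sub_right]

theorem inner_planeEmb (h₀ : ‖e₀‖ = 1) (h₁ : ‖e₁‖ = 1) (h : inner ℝ e₀ e₁ = 0) (z w : ℂ) :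
    inner ℝ (planeEmb e₀ e₁ z) (planeEmb e₀ e₁ w) = z.re * w.re + z.im * w.im := by
  simp only [planeEmb_apply, inner_add_left, inner_add_right, real_inner_smul_left,
    real_inner_smul_right, real_inner_self_eq_norm_sq, h₀, h₁, h, real_inner_comm e₀ e₁]
  ring

theorem norm_planeEmb (h₀ : ‖e₀‖ = 1) (h₁ : ‖e₁‖ = 1) (h : inner ℝ e₀ e₁ = 0) (z : ℂ) :
    ‖planeEmb e₀ e₁ z‖ = ‖z‖ := by
  rw [← sq_eq_sq₀ (norm_nonneg _) (norm_nonneg _), ← real_inner_self_eq_norm_sq,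
    inner_planeEmb h₀ h₁ h, Complex.sq_norm, Complex.normSq_apply]

theorem planeProj_planeEmb (h₀ : ‖e₀‖ = 1) (h₁ : ‖e₁‖ = 1) (h : inner ℝ e₀ e₁ = 0) (z : ℂ) :
    planeProj e₀ e₁ (planeEmb e₀ e₁ z) = z := by
  apply Complex.ext <;>
  simp [planeProj, planeEmb_apply, inner_add_right, real_inner_smul_right, h₀, h₁, h, real_inner_comm e₀ e₁]

/-- Bessel's inequality, from Cauchy–Schwarz applied to x and its projection. -/
theorem norm_planeProj_le (h₀ : ‖e₀‖ = 1) (h₁ : ‖e₁‖ = 1) (h : inner ℝ e₀ e₁ = 0) (x : H) :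
    ‖planeProj e₀ e₁ x‖ ≤ ‖x‖ := by
  set p := planeProj e₀ e₁ x with hp
  have hinner : inner ℝ x (planeEmb e₀ e₁ p) = ‖p‖ ^ 2 := by
    rw [planeEmb_apply, inner_add_right, real_inner_smul_right, real_inner_smul_right,
      real_inner_comm, real_inner_comm e₁, Complex.sq_norm, Complex.normSq_apply]
    rfl
  have := real_inner_le_norm x (planeEmb e₀ e₁ p)
  rw [hinner, norm_planeEmb h₀ h₁ h] at this
  by_contra! hlt
  nlinarith [norm_nonneg x]

/-- Every point of `Disk θ` is realized by an averaged operator acting on a plane as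
multiplication by that point. -/
theorem exists_averaged_planeEmb (hθ : 0 < θ) (h₀ : ‖e₀‖ = 1) (h₁ : ‖e₁‖ = 1)
    (h : inner ℝ e₀ e₁ = 0) {z : ℂ} (hz : z ∈ Disk θ) :
    ∃ A ∈ averaged H θ, ∃ f : H → H, (∀ x, A x = {f x}) ∧
      ∀ w, f (planeEmb e₀ e₁ w) = planeEmb e₀ e₁ (z * w) := by
  -- The solution of (1 - θ) + θq = z; membership of z in the disk says |q| ≤ 1. Projecting to the
  -- plane before multiplying by q makes N nonexpansive on all of H.
  set q : ℂ := (z - (1 - θ : ℝ)) / θ with hq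
  have hq1 : ‖q‖ ≤ 1 := by
    rw [hq, norm_div, Complex.norm_real, Real.norm_of_nonneg hθ.le]
    exact (div_le_one hθ).2 hz
  set N : H → H := fun x => planeEmb e₀ e₁ (q * planeProj e₀ e₁ x) with hN
  refine ⟨fun x => {(1 - θ) • x + θ • N x}, ⟨N, fun x y => ?_, fun _ => rfl⟩, _, fun _ => rfl,
    fun w => ?_⟩
  · rw [hN, ← map_sub, ← mul_sub, planeProj_sub, norm_planeEmb h₀ h₁ h, norm_mul]
    calc ‖q‖ * ‖planeProj e₀ e₁ (x - y)‖ ≤ 1 * ‖x - y‖ := by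
          gcongr
          exact norm_planeProj_le h₀ h₁ h _
      _ = ‖x - y‖ := one_mul _
  · have hθ' : (θ : ℂ) ≠ 0 := by exact_mod_cast hθ.ne'
    simp only [hN]
    rw [planeProj_planeEmb h₀ h₁ h, ← map_smul, ← map_smul, ← map_add, Complex.real_smul,
      Complex.real_smul]
    congr 1
    rw [hq]
    field_simp
    ring

/-- The unoriented angle between z ≠ 0 and 1 is |arg z|; the sign ± in the relative graph restores
arg z. -/
theorem exists_sign_mul_exp_angle (h₀ : ‖e₀‖ = 1) (h₁ : ‖e₁‖ = 1) (h : inner ℝ e₀ e₁ = 0)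
    (z : ℂ) : ∃ s : ℝ, (s = 1 ∨ s = -1) ∧
      z = (‖z‖ : ℂ) *
        Complex.exp (s * angle (planeEmb e₀ e₁ z) (planeEmb e₀ e₁ 1) * Complex.I) := by
  by_cases hz : z = 0
  · exact ⟨1, Or.inl rfl, by simp [hz]⟩
  have hne : planeEmb e₀ e₁ z ≠ 0 ∧ planeEmb e₀ e₁ 1 ≠ 0 := by
    constructor <;> rw [← norm_ne_zero_iff, norm_planeEmb h₀ h₁ h, norm_ne_zero_iff]
    exacts [hz, one_ne_zero]
  have hang : angle (planeEmb e₀ e₁ z) (planeEmb e₀ e₁ 1) = |z.arg| := by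
    rw [angle, if_pos hne, norm_planeEmb h₀ h₁ h, norm_planeEmb h₀ h₁ h, inner_planeEmb h₀ h₁ h,
      Complex.one_re, Complex.one_im, norm_one, mul_one, mul_one, mul_zero, add_zero,
      ← Complex.cos_arg hz, ← Real.cos_abs,
      Real.arccos_cos (abs_nonneg _) (Complex.abs_arg_le_pi z)]
  rw [hang]
  obtain ⟨s, hs, hsz⟩ : ∃ s : ℝ, (s = 1 ∨ s = -1) ∧ s * |z.arg| = z.arg := by
    rcases abs_choice z.arg with h | h
    · exact ⟨1, Or.inl rfl, by rw [h, one_mul]⟩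
    · exact ⟨-1, Or.inr rfl, by rw [h]; ring⟩
  refine ⟨s, hs, ?_⟩
  rw [← Complex.ofReal_mul, hsz, Complex.norm_mul_exp_arg_mul_I]

theorem subset_srgClass (hθ₁ : 0 < θ₁) (hθ₂ : 0 < θ₂) (hH : 2 ≤ Module.rank ℝ H) :
    (fun z : ℂ => (z : OnePoint ℂ)) '' (Disk θ₁ * Disk θ₂) ⊆
      srgClass (compClass (averaged H θ₁) (averaged H θ₂)) := by
  obtain ⟨e₀, e₁, h₀, h₁, h⟩ := exists_orthonormal_pair hH
  rintro _ ⟨_, ⟨z₁, hz₁, z₂, hz₂, rfl⟩, rfl⟩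
  obtain ⟨A, hA, f, hAf, hf⟩ := exists_averaged_planeEmb hθ₁ h₀ h₁ h hz₁
  obtain ⟨B, hB, g, hBg, hg⟩ := exists_averaged_planeEmb hθ₂ h₀ h₁ h hz₂
  have hT : ∀ w, A.comp B (planeEmb e₀ e₁ w) = {planeEmb e₀ e₁ (z₁ * z₂ * w)} := fun w => by
    rw [comp_apply_of_eq_singleton hAf hBg, hg, hf, mul_assoc]
  obtain ⟨s, hs, hsz⟩ := exists_sign_mul_exp_angle h₀ h₁ h (z₁ * z₂)
  refine Set.mem_biUnion (x := A.comp B) ⟨A, hA, B, hB, rfl⟩ (Or.inl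
    ⟨planeEmb e₀ e₁ 1, planeEmb e₀ e₁ 0, planeEmb e₀ e₁ (z₁ * z₂), 0, ?_, ?_, ?_, s, hs, ?_⟩)
  · rw [hT, mul_one]; rfl
  · rw [hT, mul_zero, map_zero]; rfl
  · rw [← sub_ne_zero, ← map_sub, ← norm_ne_zero_iff, norm_planeEmb h₀ h₁ h]
    simp
  · rw [sub_zero, map_zero, sub_zero, norm_planeEmb h₀ h₁ h, norm_planeEmb h₀ h₁ h, norm_one,
      div_one, ← hsz]

end Plane
end SRG

theorem theorem1 {H : Type*} [NormedAddCommGroup H] [InnerProductSpace ℝ H] [CompleteSpace H]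
    (θ₁ θ₂ : ℝ) (hθ₁ : θ₁ ∈ Set.Ioo (0 : ℝ) 1) (hθ₂ : θ₂ ∈ Set.Ioo (0 : ℝ) 1) :
    SRG.srgClass (SRG.compClass (SRG.averaged H θ₁) (SRG.averaged H θ₂)) ⊆
        (fun z : ℂ => (z : OnePoint ℂ)) ''
          SRG.enclosedRegion (SRG.outerCurve (SRG.cartesianOval θ₁ θ₂)) ∧
      (2 ≤ Module.rank ℝ H →
        SRG.srgClass (SRG.compClass (SRG.averaged H θ₁) (SRG.averaged H θ₂)) =
          (fun z : ℂ => (z : OnePoint ℂ)) ''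
            SRG.enclosedRegion (SRG.outerCurve (SRG.cartesianOval θ₁ θ₂))) ∧
      SRG.Disk θ₁ * SRG.Disk θ₂ =
        SRG.enclosedRegion (SRG.outerCurve (SRG.cartesianOval θ₁ θ₂)) := by
  rw [← SRG.Disk_mul_Disk_eq_enclosedRegion hθ₁ hθ₂]
  exact ⟨SRG.srgClass_subset hθ₁ hθ₂, fun hH => (SRG.srgClass_subset hθ₁ hθ₂).antisymm
    (SRG.subset_srgClass hθ₁.1 hθ₂.1 hH), rfl⟩
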